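/- Let $G=(V,E)$, $E\subseteq V\times V$, be a finite directed graph (loops allowed) endowed with an involution $i\mapsto i^*$ of $V$ such that $(i,j)\in E$ if and only if $(j^*,i^*)\in E$. Suppose that for all $i,j\in V$ there is a directed path from $i$ to $j$ or from $i$ to $j^*$. For $x\in\mathbb R^E$ put $\operatorname{div}(x)(i)=\sum_{j:(i,j)\in E}x_{i,j}-\sum_{j:(j,i)\in E}x_{j,i}$. Let $(\alpha_{i,j})_{(i,j)\in E}$ be positive weights with $\alpha_{i,j}=\alpha_{j^*,i^*}$, and let $i_0\in V$ be such that $$\operatorname{div}(\alpha)(i)=\mathbb 1_{\{i=i_0^*\}}-\mathbb 1_{\{i=i_0\}}\qquad\text{for all } i\in V,$$ and such that there is a directed path from $i_0$ to $i_0^*$. Let $(X_n)_{n\ge 0}$ be the $\star$-edge-reinforced random walk started at $i_0$ with initial weights $\alpha$: $X_0=i_0$ a.s. and $$\mathbb P(X_{n+1}=j\mid X_0,\dots,X_n)=\mathbb 1_{\{(X_n,j)\in E\}}\,\frac{\alpha_{X_n,j}(n)}{\sum_{l:(X_n,l)\in E}\alpha_{X_n,l}(n)},$$ where $N_{i,j}(n)=\sum_{k=0}^{n-1}\mathbb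 1_{\{(X_k,X_{k+1})=(i,j)\}}$ and $\alpha_{i,j}(n)=\alpha_{i,j}+N_{i,j}(n)+N_{j^*,i^*}(n)$. Then almost surely the limits $Y_{i,j}=\lim_{n\to\infty}\frac1n N_{i,j}(n)$ exist for all $(i,j)\in E$, and $(Y_{i,j})_{(i,j)\in E}$ belongs to $$\mathcal L_1=\Big\{x\in(0,\infty)^E:\ x_{i,j}=x_{j^*,i^*}\ \text{for all }(i,j)\in E,\ \operatorname{div}(x)=0,\ \sum_{(i,j)\in E}x_{i,j}=1\Big\}.$$ -/

import Mathlib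

open MeasureTheory ProbabilityTheory Filter Topology

/-- A directed graph (loops allowed) on `V`, endowed with an involution `star` of the vertices such
that `(i, j)` is an edge if and only if `(star j, star i)` is an edge. -/
structure StarDigraph (V : Type*) extends Digraph V where
  star : V → V
  star_involutive : Function.Involutive star
  adj_star : ∀ i j, Adj i j ↔ Adj (star j) (star i)

namespace StarDigraph

variable {V : Type*} (G : StarDigraph V)

/-- The set `E` of directed edges; elements of `ℝ^E` are functions `G.Edge → ℝ`. -/
abbrev Edge : Type _ := {e : V × V // G.Adj e.1 e.2}

/-- The edge involution `(i, j) ↦ (star j, star i)`. -/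
def dual (e : G.Edge) : G.Edge :=
  ⟨(G.star e.1.2, G.star e.1.1), (G.adj_star e.1.1 e.1.2).1 e.2⟩

/-- There is a directed path (possibly of length zero) from `i` to `j`. -/
def Reachable (i j : V) : Prop := Relation.ReflTransGen G.Adj i j

/-- The standing connectedness assumption: for all vertices `i`, `j` there is a directed path from
`i` to `j` or from `i` to `star j`. -/
def StarConnected : Prop := ∀ i j : V, G.Reachable i j ∨ G.Reachable i (G.star j)

noncomputable instance [Finite V] : Fintype G.Edge := Fintype.ofFinite _

open Classical in
/-- The sum `x_i = ∑_{j : i → j} x_{i,j}` over the edges that leave `i`. -/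
noncomputable def outSum [Finite V] (x : G.Edge → ℝ) (i : V) : ℝ :=
  ∑ e : G.Edge, if e.1.1 = i then x e else 0

open Classical in
/-- The sum `∑_{j : j → i} x_{j,i}` over the edges that enter `i`. -/
noncomputable def inSum [Finite V] (x : G.Edge → ℝ) (i : V) : ℝ :=
  ∑ e : G.Edge, if e.1.2 = i then x e else 0

/-- The divergence operator `ℝ^E → ℝ^V`. -/
noncomputable def div [Finite V] (x : G.Edge → ℝ) (i : V) : ℝ :=
  G.outSum x i - G.inSum x i

open Classical in
/-- The divergence assumption `div(α)(i) = 1_{i = i₀*} - 1_{i = i₀}` for all `i`. -/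
def DivergenceAssumption [Finite V] (α : G.Edge → ℝ) (i₀ : V) : Prop :=
  ∀ i : V, G.div α i = (if i = G.star i₀ then 1 else 0) - (if i = i₀ then 1 else 0)

/-- The space `ℋ` of functions on the edges that are invariant under the edge involution. -/
def spaceH : Set (G.Edge → ℝ) := {x | ∀ e, x e = x (G.dual e)}

/-- The space `𝒟` of divergence-free functions on the edges. -/
def spaceD [Finite V] : Set (G.Edge → ℝ) := {x | ∀ i, G.div x i = 0}

/-- `ℒ = ℋ ∩ 𝒟`. -/
def spaceL [Finite V] : Set (G.Edge → ℝ) := G.spaceH ∩ G.spaceD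

/-- `ℒ₁ = (0, ∞)^E ∩ ℒ ∩ {∑_{e ∈ E} x_e = 1}`. -/
def spaceL1 [Finite V] : Set (G.Edge → ℝ) :=
  {x | ∀ e, 0 < x e} ∩ G.spaceL ∩ {x | ∑ e, x e = 1}

open Classical in
/-- `N_{i,j}(n)`: the number of `k < n` with `(x_k, x_{k+1}) = (i, j)`. -/
noncomputable def crossings (x : ℕ → V) (n : ℕ) (e : G.Edge) : ℕ :=
  ((Finset.range n).filter fun k => (x k, x (k + 1)) = e.1).card

/-- `α_{i,j}(n) = α_{i,j} + N_{i,j}(n) + N_{j*,i*}(n)`. -/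
noncomputable def weight (α : G.Edge → ℝ) (x : ℕ → V) (n : ℕ) (e : G.Edge) : ℝ :=
  α e + G.crossings x n e + G.crossings x n (G.dual e)

open Classical in
/-- The probability with which the walk, having followed `x_0, …, x_n`, jumps to `j` at time
`n + 1`. -/
noncomputable def jumpProb [Finite V] (α : G.Edge → ℝ) (x : ℕ → V) (n : ℕ) (j : V) : ℝ :=
  if h : G.Adj (x n) j then
    G.weight α x n ⟨(x n, j), h⟩ / G.outSum (G.weight α x n) (x n)
  else 0

/-- `(X_n)` is a `⋆`-edge-reinforced random walk with initial weights `α` started at `i₀`.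
The conditional law of `X_{n+1}` given `X_0, …, X_n` is given on each event
`{X_0 = x_0, …, X_n = x_n}` of positive probability. -/
structure IsStarERRW [Finite V] (α : G.Edge → ℝ) (i₀ : V) {Ω : Type*} [MeasurableSpace Ω]
    (P : Measure Ω) (X : ℕ → Ω → V) : Prop where
  measurable : ∀ n, Measurable[_, (⊤ : MeasurableSpace V)] (X n)
  start : ∀ᵐ ω ∂P, X 0 ω = i₀
  step : ∀ (n : ℕ) (x : ℕ → V), P {ω | ∀ k ≤ n, X k ω = x k} ≠ 0 → ∀ j : V,
    (P[|{ω | ∀ k ≤ n, X k ω = x k}]).real {ω | X (n + 1) ω = j} = G.jumpProb α x n j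

end StarDigraph

/-! Write α_e(n) for the weight of an edge and α_i(n) for the total weight leaving i. Count each
crossing of e = (i,j) with the inverse of its current weight, and subtract the compensator, which is
1/α_i(k) at each visit to i. This `score` is a martingale. Each crossing raises α_e by at least one,
so the sum of 1/α_e² over crossings telescopes to a deterministic bound and the martingale is
bounded in L² (`integral_score_sq_le`, `ae_exists_tendsto_score`). The remaining asymptotic argument
is deterministic, for a path along edges whose scores all converge.

Let T_i be the `clock`, the sum of 1/α_i(k) over visits to i. Since α_e grows by crossings of both e
and its dual, log α_{i,j} - T_i - T_{j*} converges (`exists_tendsto_log_weight`). The divergence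
condition keeps α_i and α_{i*} within distance one, so log α_i - T_i - T_{i*} converges too
(`exists_tendsto_log_outSum`). Thus α_{i,j}/α_i is exp(T_{j*} - T_{i*}) times a factor tending to a
positive k_{i,j}. As the transition probabilities out of i sum to 1, the normalised vector
exp(T_{i*}) is fixed by matrices converging to k. Perron uniqueness
(`exists_tendsto_of_asymptotically_fixed`) makes this vector converge to a positive limit, and hence
the transition probabilities converge to some p > 0 (`exists_tendsto_transition`).

The normalised vertex weights are then almost invariant under p, so they converge to its invariant
law. By Kronecker's lemma, crossings of (i,j) equal p_{i,j} times visits to i up to o(n), so visit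
frequencies converge to the same law (`exists_tendsto_crossings`). The limit inherits symmetry from
the weights and zero divergence from invariance. -/

/-! ### Real sequences: logarithmic sums and Kronecker's lemma. -/

/-- If `a` increases by steps in `[0, 2]`, then `log a` is the discrete integral of `da / a` up to a
convergent error. -/
theorem exists_tendsto_log_sub_sum_div {a d : ℕ → ℝ} (h0 : 0 < a 0) (hd : ∀ k, 0 ≤ d k)
    (hd2 : ∀ k, d k ≤ 2) (hs : ∀ k, a (k + 1) = a k + d k) :
    ∃ l, Tendsto (fun n => Real.log (a n) - ∑ k ∈ Finset.range n, d k / a k) atTop (𝓝 l) := by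
  have hpos : ∀ k, 0 < a k := by
    intro k
    induction k with
    | zero => exact h0
    | succ k ih => rw [hs]; linarith [hd k]
  have hlog : ∀ k, Real.log (a (k + 1)) = Real.log (a k) + Real.log (1 + d k / a k) := by
    intro k
    have h1 : 0 ≤ d k / a k := div_nonneg (hd k) (hpos k).le
    rw [← Real.log_mul (hpos k).ne' (by positivity), hs]
    congr 1
    have := (hpos k).ne'
    field_simp
  have hanti : Antitone (fun n => Real.log (a n) - ∑ k ∈ Finset.range n, d k / a k) := by
    refine antitone_nat_of_succ_le fun n => ?_
    rw [Finset.sum_range_succ, hlog]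
    have h1 : 0 ≤ d n / a n := div_nonneg (hd n) (hpos n).le
    have := Real.log_le_sub_one_of_pos (show (0 : ℝ) < 1 + d n / a n by positivity)
    linarith
  -- The second-order error is at most d²/(a(a+d)) ≤ 2d/(a(a+d)) = 2/a_n - 2/a_{n+1}, which
  -- telescopes.
  have hbd : ∀ n, Real.log (a 0) - 2 / a 0 + 2 / a n ≤
      Real.log (a n) - ∑ k ∈ Finset.range n, d k / a k := by
    intro n
    induction n with
    | zero => simp
    | succ n ih =>
      rw [Finset.sum_range_succ, hlog]
      have h1 : 0 ≤ d n / a n := div_nonneg (hd n) (hpos n).le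
      have h2 := Real.one_sub_inv_le_log_of_pos (show (0 : ℝ) < 1 + d n / a n by positivity)
      have h3 : d n / a n - (1 - (1 + d n / a n)⁻¹) ≤ 2 / a n - 2 / a (n + 1) := by
        have ha := hpos n
        have ha' := hpos (n + 1)
        rw [hs] at ha' ⊢
        have e1 : d n / a n - (1 - (1 + d n / a n)⁻¹) = d n * d n / (a n * (a n + d n)) := by
          field_simp
          ring
        have e2 : 2 / a n - 2 / (a n + d n) = 2 * d n / (a n * (a n + d n)) := by
          field_simp
          ring
        rw [e1, e2]
        gcongr
        · exact hd n
        · exact hd2 n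
      linarith
  refine ⟨_, tendsto_atTop_ciInf hanti ⟨Real.log (a 0) - 2 / a 0, ?_⟩⟩
  rintro _ ⟨n, rfl⟩
  have := hbd n
  have h2 : 0 ≤ 2 / a n := div_nonneg two_pos.le (hpos n).le
  simp only
  linarith

/-- If `a` is unbounded, the ratio tends to 1; otherwise both sequences converge to positive limits.
-/
theorem exists_tendsto_log_sub_log {a b : ℕ → ℝ} (ha : Monotone a) (hb : Monotone b)
    (ha0 : 0 < a 0) (hb0 : 0 < b 0) (hab : ∀ n, |b n - a n| ≤ 1) :
    ∃ l, Tendsto (fun n => Real.log (b n) - Real.log (a n)) atTop (𝓝 l) := by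
  have hapos : ∀ n, 0 < a n := fun n => ha0.trans_le (ha n.zero_le)
  have hbpos : ∀ n, 0 < b n := fun n => hb0.trans_le (hb n.zero_le)
  rcases tendsto_atTop_of_monotone ha with h | ⟨l, hl⟩
  · refine ⟨Real.log 1, ?_⟩
    have h1 : Tendsto (fun n => (b n - a n) / a n) atTop (𝓝 0) := by
      rw [tendsto_zero_iff_abs_tendsto_zero]
      refine squeeze_zero (fun n => abs_nonneg _) (fun n => ?_) h.inv_tendsto_atTop
      simp only [Function.comp, abs_div, abs_of_pos (hapos n), Pi.inv_apply]
      rw [div_eq_mul_inv]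
      exact mul_le_of_le_one_left (inv_nonneg.2 (hapos n).le) (hab n)
    have h2 : Tendsto (fun n => b n / a n) atTop (𝓝 1) := by
      have := h1.const_add 1
      rw [add_zero] at this
      refine this.congr fun n => ?_
      have := (hapos n).ne'
      field_simp
      ring
    refine (h2.log one_ne_zero).congr fun n => ?_
    rw [Real.log_div (hbpos n).ne' (hapos n).ne']
  · have hbb : BddAbove (Set.range b) := by
      refine ⟨l + 1, ?_⟩
      rintro _ ⟨n, rfl⟩
      have h1 := ha.ge_of_tendsto hl n
      have h2 := (abs_le.1 (hab n)).2
      linarith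
    have hm := tendsto_atTop_ciSup hb hbb
    have hl0 : 0 < l := ha0.trans_le (ha.ge_of_tendsto hl 0)
    have hm0 : 0 < ⨆ n, b n := hb0.trans_le (hb.ge_of_tendsto hm 0)
    exact ⟨_, (hm.log hm0.ne').sub (hl.log hl0.ne')⟩

/-- Kronecker's lemma. -/
theorem tendsto_sum_mul_div_zero {a b : ℕ → ℝ} {l : ℝ} (hb : Monotone b)
    (hbt : Tendsto b atTop atTop)
    (ha : Tendsto (fun n => ∑ k ∈ Finset.range n, a k) atTop (𝓝 l)) :
    Tendsto (fun n => (∑ k ∈ Finset.range n, b k * a k) / b n) atTop (𝓝 0) := by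
  set t : ℕ → ℝ := fun n => ∑ k ∈ Finset.range n, a k - l with ht
  have ht0 : Tendsto t atTop (𝓝 0) := by simpa using ha.sub_const l
  -- Summation by parts uses the partial sums recentred at their limit, so that `t` tends to 0.
  have habel : ∀ n, ∑ k ∈ Finset.range n, b k * a k =
      b n * t n - b 0 * t 0 - ∑ k ∈ Finset.range n, (b (k + 1) - b k) * t (k + 1) := by
    intro n
    induction n with
    | zero => simp
    | succ n ih =>
      rw [Finset.sum_range_succ, ih, Finset.sum_range_succ]
      simp only [ht, Finset.sum_range_succ]
      ring
  have hsum : ∀ n, ∑ k ∈ Finset.range n, (b (k + 1) - b k) = b n - b 0 :=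
    fun n => Finset.sum_range_sub b n
  have ho : (fun n => ∑ k ∈ Finset.range n, (b (k + 1) - b k) * t (k + 1)) =o[atTop]
      fun n => ∑ k ∈ Finset.range n, (b (k + 1) - b k) := by
    refine Asymptotics.IsLittleO.sum_range ?_ (fun n => sub_nonneg.2 (hb n.le_succ)) ?_
    · have h1 : (fun n => t (n + 1)) =o[atTop] fun _ => (1 : ℝ) :=
        (Asymptotics.isLittleO_one_iff ℝ).2 (ht0.comp (tendsto_add_atTop_nat 1))
      simpa using (Asymptotics.isBigO_refl (fun n => b (n + 1) - b n) atTop).mul_isLittleO h1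
    · simp only [hsum]
      exact tendsto_atTop_add_const_right _ _ hbt
  have hconst : ∀ c : ℝ, Tendsto (fun n => c / b n) atTop (𝓝 0) := fun c => hbt.const_div_atTop c
  have hO : (fun n => ∑ k ∈ Finset.range n, (b (k + 1) - b k)) =O[atTop] b := by
    simp only [hsum]
    refine (Asymptotics.isBigO_refl _ _).sub ?_
    exact ((Asymptotics.isLittleO_const_left).2
      (Or.inr (tendsto_norm_atTop_atTop.comp hbt))).isBigO
  have h3 := (ho.trans_isBigO hO).tendsto_div_nhds_zero
  have h4 := (ht0.sub (hconst (b 0 * t 0))).sub h3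
  simp only [sub_zero] at h4
  refine h4.congr' ?_
  filter_upwards [hbt.eventually_gt_atTop 0] with n hn
  rw [habel]
  field_simp

/-! ### Perron-type uniqueness and stability for positive operators on a strongly connected graph.
-/

section Perron

variable {V E : Type*} [Fintype E] [DecidableEq V]

/-- A vanishing sum of nonnegative terms with positive coefficients forces zeros at all successors;
these spread along paths. -/
theorem eq_zero_of_positive_operator_fixed {s t : E → V} {k : E → ℝ} (hk : ∀ e, 0 < k e)
    (hirr : ∀ i j, Relation.ReflTransGen (fun a b => ∃ e, s e = a ∧ t e = b) i j)
    {u : V → ℝ} (hu : ∀ i, 0 ≤ u i) (hfix : ∀ i, ∑ e, (if s e = i then k e * u (t e) else 0) = u i)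
    {i : V} (hi : u i = 0) (j : V) : u j = 0 := by
  induction hirr i j with
  | refl => exact hi
  | @tail b c _ hbc ih =>
    obtain ⟨e, rfl, rfl⟩ := hbc
    have h := hfix (s e)
    rw [ih, Finset.sum_eq_zero_iff_of_nonneg] at h
    · have := h e (Finset.mem_univ e)
      rw [if_pos rfl] at this
      exact (mul_eq_zero.1 this).resolve_left (hk e).ne'
    · intro e' _
      split_ifs
      · exact mul_nonneg (hk e').le (hu _)
      · exact le_rfl

theorem pos_of_positive_operator_fixed [Fintype V] {s t : E → V} {k : E → ℝ} (hk : ∀ e, 0 < k e)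
    (hirr : ∀ i j, Relation.ReflTransGen (fun a b => ∃ e, s e = a ∧ t e = b) i j)
    {u : V → ℝ} (hu : ∀ i, 0 ≤ u i) (hfix : ∀ i, ∑ e, (if s e = i then k e * u (t e) else 0) = u i)
    (hsum : ∑ i, u i = 1) (i : V) : 0 < u i := by
  refine (hu i).lt_of_ne fun h => ?_
  have : ∑ i, u i = 0 := Finset.sum_eq_zero fun j _ =>
    eq_zero_of_positive_operator_fixed hk hirr hu hfix h.symm j
  linarith

/-- Subtract from `u` the largest multiple of `v` lying below it: the remainder is a nonnegative
fixed vector with a zero, hence vanishes. No sign condition on `u` is needed. -/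
theorem positive_operator_fixed_unique [Fintype V] {s t : E → V} {k : E → ℝ} (hk : ∀ e, 0 < k e)
    (hirr : ∀ i j, Relation.ReflTransGen (fun a b => ∃ e, s e = a ∧ t e = b) i j)
    {u v : V → ℝ} (hufix : ∀ i, ∑ e, (if s e = i then k e * u (t e) else 0) = u i)
    (husum : ∑ i, u i = 1)
    (hv : ∀ i, 0 ≤ v i) (hvfix : ∀ i, ∑ e, (if s e = i then k e * v (t e) else 0) = v i)
    (hvsum : ∑ i, v i = 1) : u = v := by
  have hvpos := pos_of_positive_operator_fixed hk hirr hv hvfix hvsum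
  have hne : (Finset.univ : Finset V).Nonempty := by
    rw [Finset.nonempty_iff_ne_empty]
    intro h
    rw [h] at husum
    simp at husum
  obtain ⟨i, -, hi⟩ := Finset.exists_min_image Finset.univ (fun i => u i / v i) hne
  set r := u i / v i with hr
  have h0 : ∀ j, u j - r * v j = 0 := by
    refine eq_zero_of_positive_operator_fixed (u := fun j => u j - r * v j) hk hirr ?_ ?_ (i := i) ?_
    · intro j
      have := hi j (Finset.mem_univ j)
      rw [le_div_iff₀ (hvpos j)] at this
      simpa using this
    · intro j
      rw [← hufix j, ← hvfix j, Finset.mul_sum, ← Finset.sum_sub_distrib]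
      refine Finset.sum_congr rfl fun e _ => ?_
      split_ifs <;> ring
    · rw [hr]
      have := (hvpos i).ne'
      field_simp
      ring
  have hr1 : r = 1 := by
    have h1 : ∑ j, (u j - r * v j) = 0 := Finset.sum_eq_zero fun j _ => h0 j
    rw [Finset.sum_sub_distrib, ← Finset.mul_sum, husum, hvsum] at h1
    linarith
  funext j
  have := h0 j
  rw [hr1] at this
  linarith

/-- The simplex is compact, every cluster point is fixed by the limit operator, and that operator
has only one fixed point there. -/
theorem exists_tendsto_of_asymptotically_fixed [Fintype V] {s t : E → V} {k : E → ℝ} (hk : ∀ e, 0 < k e)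
    (hirr : ∀ i j, Relation.ReflTransGen (fun a b => ∃ e, s e = a ∧ t e = b) i j)
    {kn : ℕ → E → ℝ} (hkn : ∀ e, Tendsto (fun n => kn n e) atTop (𝓝 (k e)))
    {un : ℕ → V → ℝ} (hun : ∀ n i, 0 ≤ un n i) (hsum : ∀ᶠ n in atTop, ∑ i, un n i = 1)
    (hfix : ∀ i, Tendsto (fun n => ∑ e, (if s e = i then kn n e * un n (t e) else 0) - un n i)
      atTop (𝓝 0)) :
    ∃ u : V → ℝ, (∀ i, Tendsto (fun n => un n i) atTop (𝓝 (u i))) ∧ (∀ i, 0 < u i) ∧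
      ∑ i, u i = 1 ∧ ∀ i, ∑ e, (if s e = i then k e * u (t e) else 0) = u i := by
  have hmem : ∀ᶠ n in atTop, un n ∈ stdSimplex ℝ V := by
    filter_upwards [hsum] with n hn using ⟨hun n, hn⟩
  have hcl : ∀ u : V → ℝ, MapClusterPt u atTop un →
      ∀ i, ∑ e, (if s e = i then k e * u (t e) else 0) = u i := by
    intro u hcu i
    obtain ⟨φ, hφ, hlim⟩ := hcu.tendsto_subseq
    have h1 := (hfix i).comp hφ.tendsto_atTop
    have h2 : Tendsto (fun n => ∑ e, (if s e = i then kn (φ n) e * un (φ n) (t e) else 0)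
        - un (φ n) i) atTop (𝓝 (∑ e, (if s e = i then k e * u (t e) else 0) - u i)) := by
      refine (tendsto_finsetSum _ fun e _ => ?_).sub (tendsto_pi_nhds.1 hlim i)
      split_ifs
      · exact ((hkn e).comp hφ.tendsto_atTop).mul (tendsto_pi_nhds.1 hlim (t e))
      · exact tendsto_const_nhds
    have := tendsto_nhds_unique h2 h1
    linarith
  obtain ⟨u, hu, hcu⟩ := (isCompact_stdSimplex ℝ V).exists_mapClusterPt (f := atTop)
    (tendsto_principal.2 hmem)
  have hufix := hcl u hcu
  have ht : Tendsto un atTop (𝓝 u) := by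
    refine (isCompact_stdSimplex ℝ V).tendsto_nhds_of_unique_mapClusterPt hmem ?_
    intro v hv hcv
    exact positive_operator_fixed_unique hk hirr (hcl v hcv) hv.2 hu.1 hufix hu.2
  exact ⟨u, tendsto_pi_nhds.1 ht, pos_of_positive_operator_fixed hk hirr hu.1 hufix hu.2, hu.2, hufix⟩

end Perron

/-! ### Deterministic analysis of a single path. -/

namespace StarDigraph

open Classical

variable {V : Type*} (G : StarDigraph V)

theorem dual_dual (e : G.Edge) : G.dual (G.dual e) = e := by
  apply Subtype.ext
  simp only [dual, G.star_involutive _]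

theorem Reachable.dual {G : StarDigraph V} {i j : V} (h : G.Reachable i j) :
    G.Reachable (G.star j) (G.star i) := by
  induction h with
  | refl => exact Relation.ReflTransGen.refl
  | tail _ h ih => exact Relation.ReflTransGen.head ((G.adj_star _ _).1 h) ih

/-- The indicator that the path `x` crosses `e` at time `k`. -/
noncomputable def crossAt (x : ℕ → V) (k : ℕ) (e : G.Edge) : ℝ :=
  if (x k, x (k + 1)) = e.1 then 1 else 0

/-- The indicator that the path `x` is at `i` at time `k`. -/
noncomputable def visitAt (x : ℕ → V) (k : ℕ) (i : V) : ℝ := if x k = i then 1 else 0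

theorem visitAt_nonneg (x : ℕ → V) (k : ℕ) (i : V) : 0 ≤ visitAt x k i := by
  unfold visitAt; split_ifs <;> norm_num

theorem visitAt_le_one (x : ℕ → V) (k : ℕ) (i : V) : visitAt x k i ≤ 1 := by
  unfold visitAt; split_ifs <;> norm_num

theorem crossAt_nonneg (x : ℕ → V) (k : ℕ) (e : G.Edge) : 0 ≤ G.crossAt x k e := by
  unfold crossAt; split_ifs <;> norm_num

theorem crossAt_le_one (x : ℕ → V) (k : ℕ) (e : G.Edge) : G.crossAt x k e ≤ 1 := by
  unfold crossAt; split_ifs <;> norm_num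

theorem crossings_eq_sum (x : ℕ → V) (n : ℕ) (e : G.Edge) :
    (G.crossings x n e : ℝ) = ∑ k ∈ Finset.range n, G.crossAt x k e := by
  simp only [crossings, crossAt, Finset.sum_boole]

variable (α : G.Edge → ℝ) (x : ℕ → V)

theorem weight_zero (e : G.Edge) : G.weight α x 0 e = α e := by simp [weight, crossings]

theorem weight_succ (n : ℕ) (e : G.Edge) : G.weight α x (n + 1) e =
    G.weight α x n e + (G.crossAt x n e + G.crossAt x n (G.dual e)) := by
  simp only [weight, crossings_eq_sum, Finset.sum_range_succ]
  ring

variable {α x}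

theorem weight_monotone (e : G.Edge) : Monotone fun n => G.weight α x n e := by
  refine monotone_nat_of_le_succ fun n => ?_
  rw [weight_succ]
  linarith [G.crossAt_nonneg x n e, G.crossAt_nonneg x n (G.dual e)]

theorem weight_pos (hα : ∀ e, 0 < α e) (n : ℕ) (e : G.Edge) : 0 < G.weight α x n e := by
  unfold weight
  have := hα e
  positivity

theorem weight_dual (hs : ∀ e, α e = α (G.dual e)) (n : ℕ) (e : G.Edge) :
    G.weight α x n (G.dual e) = G.weight α x n e := by
  simp only [weight, dual_dual, ← hs e]
  ring

variable [Fintype V]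

theorem sum_outSum (f : G.Edge → ℝ) : ∑ i, G.outSum f i = ∑ e, f e := by
  simp only [outSum]
  rw [Finset.sum_comm]
  simp

theorem outSum_dual (f : G.Edge → ℝ) (i : V) :
    G.outSum (fun e => f (G.dual e)) i = G.inSum f (G.star i) := by
  unfold outSum inSum
  refine Fintype.sum_equiv (Function.Involutive.toPerm G.dual G.dual_dual) _ _ fun e => ?_
  have : (G.dual e).1.2 = G.star i ↔ e.1.1 = i := G.star_involutive.injective.eq_iff
  change _ = if (G.dual e).1.2 = G.star i then f (G.dual e) else 0
  simp only [this]

theorem inSum_eq_outSum_star {f : G.Edge → ℝ} (hf : ∀ e, f (G.dual e) = f e) (i : V) :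
    G.inSum f i = G.outSum f (G.star i) := by
  rw [← G.star_involutive i, ← outSum_dual, G.star_involutive]
  simp only [hf]

theorem outSum_add (f g : G.Edge → ℝ) (i : V) :
    G.outSum (fun e => f e + g e) i = G.outSum f i + G.outSum g i := by
  simp only [outSum, ← Finset.sum_add_distrib]
  exact Finset.sum_congr rfl fun e _ => by split_ifs <;> simp

theorem outSum_pos {f : G.Edge → ℝ} (hf : ∀ e, 0 < f e) (e : G.Edge) :
    0 < G.outSum f e.1.1 := by
  refine Finset.sum_pos' (fun e' _ => ?_) ⟨e, Finset.mem_univ e, ?_⟩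
  · split_ifs
    · exact (hf e').le
    · exact le_rfl
  · rw [if_pos rfl]
    exact hf e

section Path

variable (hadj : ∀ k, G.Adj (x k) (x (k + 1)))
include hadj

omit [Fintype V] in
theorem crossAt_eq (k : ℕ) (e : G.Edge) :
    G.crossAt x k e = if (⟨(x k, x (k + 1)), hadj k⟩ : G.Edge) = e then 1 else 0 := by
  simp only [crossAt, Subtype.ext_iff]

theorem sum_crossAt (k : ℕ) : ∑ e, G.crossAt x k e = 1 := by
  simp [G.crossAt_eq hadj]

theorem outSum_crossAt (k : ℕ) (i : V) : G.outSum (G.crossAt x k) i = visitAt x k i := by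
  simp only [outSum, G.crossAt_eq hadj]
  rw [Finset.sum_eq_single ⟨(x k, x (k + 1)), hadj k⟩]
  · simp [visitAt]
  · intro e _ he
    simp [he.symm]
  · simp

theorem inSum_crossAt (k : ℕ) (i : V) : G.inSum (G.crossAt x k) i = visitAt x (k + 1) i := by
  simp only [inSum, G.crossAt_eq hadj]
  rw [Finset.sum_eq_single ⟨(x k, x (k + 1)), hadj k⟩]
  · simp [visitAt]
  · intro e _ he
    simp [he.symm]
  · simp

theorem outSum_weight_succ (n : ℕ) (i : V) : G.outSum (G.weight α x (n + 1)) i =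
    G.outSum (G.weight α x n) i + (visitAt x n i + visitAt x (n + 1) (G.star i)) := by
  rw [← G.outSum_crossAt hadj, ← G.inSum_crossAt hadj, ← outSum_dual, ← outSum_add, ← outSum_add]
  congr 1
  funext e
  rw [weight_succ]

theorem sum_weight (n : ℕ) : ∑ e, G.weight α x n e = ∑ e, α e + 2 * n := by
  induction n with
  | zero => simp [weight_zero]
  | succ n ih =>
    have h : ∑ e, G.crossAt x n (G.dual e) = 1 := by
      rw [← G.sum_crossAt hadj n]
      exact Fintype.sum_equiv (Function.Involutive.toPerm G.dual G.dual_dual) _ _ fun e => rfl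
    simp only [weight_succ, Finset.sum_add_distrib, ih, h, G.sum_crossAt hadj]
    push_cast
    ring

/-- At time 0 this is the divergence condition with `i₀ = x 0`; each step then changes both sides
equally. -/
theorem outSum_weight_star (hs : ∀ e, α e = α (G.dual e)) (hdiv : G.DivergenceAssumption α (x 0))
    (n : ℕ) (i : V) : G.outSum (G.weight α x n) (G.star i) - G.outSum (G.weight α x n) i =
      visitAt x n i - visitAt x n (G.star i) := by
  induction n with
  | zero =>
    have h0 : G.weight α x 0 = α := funext fun e => G.weight_zero α x e
    have h := hdiv i
    rw [h0]
    rw [StarDigraph.div, G.inSum_eq_outSum_star fun e => (hs e).symm] at h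
    have h1 : (x 0 = G.star i) ↔ (i = G.star (x 0)) :=
      ⟨fun h => by rw [h, G.star_involutive], fun h => by rw [h, G.star_involutive]⟩
    simp only [visitAt, h1, eq_comm (a := x 0) (b := i)]
    linarith
  | succ n ih =>
    rw [G.outSum_weight_succ hadj, G.outSum_weight_succ hadj, G.star_involutive]
    linarith

end Path

/-- Divergence and `⋆`-connectedness force strong connectedness. -/
theorem reachable_of_starConnected (hG : G.StarConnected) (hα : ∀ e, 0 < α e) {i₀ : V}
    (hdiv : G.DivergenceAssumption α i₀) (hi₀ : G.Reachable i₀ (G.star i₀)) (i j : V) :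
    G.Reachable i j := by
  have hback : G.Reachable (G.star i₀) i₀ := by
    by_contra hne
    -- No edge leaves `R`, so its total divergence is at most 0; yet `R` contains `star i₀` and not
    -- `i₀`, which makes it 1.
    set R : Finset V := Finset.univ.filter fun v => G.Reachable (G.star i₀) v with hR
    have h1 : ∑ v ∈ R, G.div α v = 1 := by
      rw [Finset.sum_congr rfl fun v _ => hdiv v, Finset.sum_sub_distrib]
      have : G.Reachable (G.star i₀) (G.star i₀) := Relation.ReflTransGen.refl
      simp [hR, hne, this]
    have h2 : ∑ v ∈ R, G.div α v ≤ 0 := by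
      simp only [StarDigraph.div, outSum, inSum, Finset.sum_sub_distrib]
      rw [Finset.sum_comm, Finset.sum_comm (s := R), ← Finset.sum_sub_distrib]
      refine Finset.sum_nonpos fun e _ => ?_
      have h : e.1.1 ∈ R → e.1.2 ∈ R := by
        simp only [hR, Finset.mem_filter, Finset.mem_univ, true_and]
        exact fun h => Relation.ReflTransGen.tail h e.2
      simp only [Finset.sum_ite_eq]
      have := hα e
      split_ifs <;> simp_all [this.le]
    linarith
  have hto : ∀ v, G.Reachable v i₀ := fun v =>
    (hG v i₀).elim id fun h => Relation.ReflTransGen.trans h hback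
  have hfrom : ∀ v, G.Reachable i₀ v := fun v => by
    have := (hto (G.star v)).dual
    rw [G.star_involutive] at this
    exact Relation.ReflTransGen.trans hi₀ this
  exact Relation.ReflTransGen.trans (hto i) (hfrom j)

variable (α x) in
/-- The clock of the vertex `i`: each visit to `i` contributes the inverse of the current weight. -/
noncomputable def clock (n : ℕ) (i : V) : ℝ :=
  ∑ k ∈ Finset.range n, visitAt x k i / G.outSum (G.weight α x k) i

variable (α x) in
/-- The compensated number of crossings of `e`, each crossing being counted with the inverse of the
current weight. -/
noncomputable def score (n : ℕ) (e : G.Edge) : ℝ :=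
  ∑ k ∈ Finset.range n, (G.crossAt x k e / G.weight α x k e -
    visitAt x k e.1.1 / G.outSum (G.weight α x k) e.1.1)

/-- The logarithmic sum of the increments of the weight is the score of `e` plus that of its dual,
plus the clocks at their two tails. -/
theorem exists_tendsto_log_weight (hα : ∀ e, 0 < α e) (hs : ∀ e, α e = α (G.dual e))
    (hconv : ∀ e, ∃ l, Tendsto (fun n => G.score α x n e) atTop (𝓝 l)) (e : G.Edge) :
    ∃ l, Tendsto (fun n => Real.log (G.weight α x n e) - G.clock α x n e.1.1 -
      G.clock α x n (G.star e.1.2)) atTop (𝓝 l) := by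
  obtain ⟨l₁, h₁⟩ := hconv e
  obtain ⟨l₂, h₂⟩ := hconv (G.dual e)
  obtain ⟨l, h⟩ := exists_tendsto_log_sub_sum_div (a := fun n => G.weight α x n e)
    (d := fun n => G.crossAt x n e + G.crossAt x n (G.dual e)) (G.weight_pos hα 0 e)
    (fun k => add_nonneg (G.crossAt_nonneg _ _ _) (G.crossAt_nonneg _ _ _))
    (fun k => by linarith [G.crossAt_le_one x k e, G.crossAt_le_one x k (G.dual e)])
    (fun k => G.weight_succ α x k e)
  refine ⟨_, ((h.add h₁).add h₂).congr fun n => ?_⟩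
  simp only [score, clock, Finset.sum_sub_distrib, add_div, Finset.sum_add_distrib,
    G.weight_dual hs, show (G.dual e).1.1 = G.star e.1.2 from rfl]
  ring

section Path

variable (hadj : ∀ k, G.Adj (x k) (x (k + 1))) (hα : ∀ e, 0 < α e) (hs : ∀ e, α e = α (G.dual e))
  (hdiv : G.DivergenceAssumption α (x 0)) (hsc : ∀ i j, G.Reachable i j)
include hadj hα hsc

omit [Fintype V] hα in
theorem exists_edge_from (i : V) : ∃ e : G.Edge, e.1.1 = i := by
  rcases (hsc i (x 0)).cases_head with h | ⟨j, hj, -⟩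
  · exact ⟨⟨(x 0, x 1), hadj 0⟩, h.symm⟩
  · exact ⟨⟨(i, j), hj⟩, rfl⟩

theorem outSum_weight_pos (n : ℕ) (i : V) : 0 < G.outSum (G.weight α x n) i := by
  obtain ⟨e, rfl⟩ := G.exists_edge_from hadj hsc i
  exact G.outSum_pos (G.weight_pos hα n) e

include hs hdiv

theorem exists_tendsto_log_outSum (i : V) :
    ∃ l, Tendsto (fun n => Real.log (G.outSum (G.weight α x n) i) - G.clock α x n i -
      G.clock α x n (G.star i)) atTop (𝓝 l) := by
  have hwpos := fun n => G.outSum_weight_pos (x := x) hadj hα hsc n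
  have hstar := G.outSum_weight_star hadj hs hdiv
  set δ : ℝ := if G.star i = i then 1 else 0 with hδ
  -- The correction delays the increment due to arriving at `star i` by one step. Then `a k` is the
  -- vertex weight of whichever of `i`, `star i` is being visited; `δ` restores this when they
  -- coincide.
  set a : ℕ → ℝ := fun n => G.outSum (G.weight α x n) i - visitAt x n (G.star i) + δ with ha
  set d : ℕ → ℝ := fun n => visitAt x n i + visitAt x n (G.star i) with hd
  have hd0 : ∀ n, 0 ≤ d n := fun n => add_nonneg (visitAt_nonneg _ _ _) (visitAt_nonneg _ _ _)
  have has : ∀ n, a (n + 1) = a n + d n := fun n => by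
    simp only [ha, hd, G.outSum_weight_succ hadj]
    ring
  have ha0 : 0 < a 0 := by
    have h1 := hwpos 0 i
    have h2 := hwpos 0 (G.star i)
    have h3 := hstar 0 i
    simp only [ha, hδ]
    simp only [visitAt] at h3 ⊢
    by_cases h : G.star i = i
    · simp only [h, if_true]
      split_ifs <;> linarith
    · by_cases h' : x 0 = G.star i
      · simp only [h', if_neg h, if_true] at h3 ⊢
        linarith
      · simp only [if_neg h', if_neg h]
        linarith
  have hterm : ∀ k, d k / a k = visitAt x k i / G.outSum (G.weight α x k) i +
      visitAt x k (G.star i) / G.outSum (G.weight α x k) (G.star i) := by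
    intro k
    have h3 := hstar k i
    simp only [ha, hd, hδ]
    simp only [visitAt] at h3 ⊢
    by_cases h : G.star i = i
    · simp only [h, if_true]
      split_ifs
      · ring
      · simp
    · by_cases h' : x k = G.star i
      · simp only [h', if_neg h, if_true] at h3 ⊢
        have : G.outSum (G.weight α x k) (G.star i) = G.outSum (G.weight α x k) i - 1 := by
          linarith
        rw [this]
        simp
      · simp only [if_neg h', if_neg h]
        simp
  obtain ⟨l₁, h₁⟩ := exists_tendsto_log_sub_sum_div ha0 hd0
    (fun k => by linarith [visitAt_le_one x k i, visitAt_le_one x k (G.star i)]) has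
  obtain ⟨l₂, h₂⟩ := exists_tendsto_log_sub_log (a := a)
    (b := fun n => G.outSum (G.weight α x n) i)
    (monotone_nat_of_le_succ fun n => by rw [has]; linarith [hd0 n])
    (monotone_nat_of_le_succ fun n => by
      rw [G.outSum_weight_succ hadj]
      linarith [visitAt_nonneg x n i, visitAt_nonneg x (n + 1) (G.star i)]) ha0 (hwpos 0 i)
    (fun n => by
      simp only [ha, hδ, visitAt]
      split_ifs <;> norm_num)
  refine ⟨_, (h₁.add h₂).congr fun n => ?_⟩
  simp only [hterm, clock, Finset.sum_add_distrib]
  ring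

/-- If the scores converge, then so do the transition probabilities. -/
theorem exists_tendsto_transition
    (hconv : ∀ e, ∃ l, Tendsto (fun n => G.score α x n e) atTop (𝓝 l)) :
    ∃ p : G.Edge → ℝ, (∀ e, 0 < p e) ∧ ∀ e, Tendsto (fun n => G.weight α x n e /
      G.outSum (G.weight α x n) e.1.1) atTop (𝓝 (p e)) := by
  have hwpos := fun n => G.outSum_weight_pos (x := x) hadj hα hsc n
  choose l hl using G.exists_tendsto_log_weight hα hs hconv
  choose m hm using G.exists_tendsto_log_outSum hadj hα hs hdiv hsc
  set k : G.Edge → ℝ := fun e => Real.exp (l e - m e.1.1) with hk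
  -- Conjugating the transition matrix by exp(T_{i*}) removes the clocks, whose individual
  -- convergence is unknown.
  set kn : ℕ → G.Edge → ℝ := fun n e => G.weight α x n e / G.outSum (G.weight α x n) e.1.1 *
    (Real.exp (G.clock α x n (G.star e.1.1)) / Real.exp (G.clock α x n (G.star e.1.2))) with hkn
  have hlim : ∀ e, Tendsto (fun n => kn n e) atTop (𝓝 (k e)) := by
    intro e
    refine (Real.continuous_exp.continuousAt.tendsto.comp ((hl e).sub (hm e.1.1))).congr fun n => ?_
    simp only [Function.comp, hkn]
    rw [← Real.exp_sub]
    conv_rhs => rw [← Real.exp_log (G.weight_pos (x := x) hα n e),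
      ← Real.exp_log (hwpos n e.1.1), ← Real.exp_sub, ← Real.exp_add]
    congr 1
    ring
  set H : ℕ → ℝ := fun n => ∑ i, Real.exp (G.clock α x n (G.star i)) with hH
  have hHpos : ∀ n, 0 < H n := fun n =>
    Finset.sum_pos (fun i _ => Real.exp_pos _) ⟨x 0, Finset.mem_univ _⟩
  set un : ℕ → V → ℝ := fun n i => Real.exp (G.clock α x n (G.star i)) / H n with hun
  have hunpos : ∀ n i, 0 < un n i := fun n i => div_pos (Real.exp_pos _) (hHpos n)
  have hkun : ∀ n e, kn n e * un n e.1.2 =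
      G.weight α x n e / G.outSum (G.weight α x n) e.1.1 * un n e.1.1 := by
    intro n e
    simp only [hkn, hun]
    have := (Real.exp_pos (G.clock α x n (G.star e.1.2))).ne'
    field_simp
  obtain ⟨u, hu, hupos, -, -⟩ := exists_tendsto_of_asymptotically_fixed
    (s := fun e : G.Edge => e.1.1) (t := fun e => e.1.2) (k := k) (kn := kn) (un := un)
    (fun e => Real.exp_pos _)
    (fun i j => Relation.ReflTransGen.mono (fun a b h => ⟨⟨(a, b), h⟩, rfl, rfl⟩) i j (hsc i j)) hlim
    (fun n i => (hunpos n i).le)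
    (Eventually.of_forall fun n => by
      simp only [hun]
      rw [← Finset.sum_div, div_self (hHpos n).ne'])
    (fun i => by
      refine tendsto_const_nhds.congr fun n => ?_
      have h1 : ∑ e : G.Edge, (if e.1.1 = i then kn n e * un n e.1.2 else 0) =
          ∑ e : G.Edge, (if e.1.1 = i then G.weight α x n e else 0) *
            (un n i / G.outSum (G.weight α x n) i) := by
        refine Finset.sum_congr rfl fun e _ => ?_
        split_ifs with h
        · rw [hkun, h]
          ring
        · simp
      rw [h1, ← Finset.sum_mul]
      change 0 = G.outSum (G.weight α x n) i * _ - _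
      have := (hwpos n i).ne'
      field_simp
      ring)
  refine ⟨fun e => k e * u e.1.2 / u e.1.1,
    fun e => div_pos (mul_pos (Real.exp_pos _) (hupos _)) (hupos _), fun e => ?_⟩
  refine (((hlim e).mul (hu e.1.2)).div (hu e.1.1) (hupos _).ne').congr fun n => ?_
  rw [Pi.div_apply, hkun, mul_div_cancel_right₀ _ (hunpos n e.1.1).ne']

/-- If the scores converge, then the proportions of crossings converge to a point of `ℒ₁`. -/
theorem exists_tendsto_crossings
    (hconv : ∀ e, ∃ l, Tendsto (fun n => G.score α x n e) atTop (𝓝 l)) :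
    ∃ z ∈ G.spaceL1, ∀ e, Tendsto (fun n : ℕ => (G.crossings x n e : ℝ) / n) atTop (𝓝 (z e)) := by
  have hwpos := fun n => G.outSum_weight_pos (x := x) hadj hα hsc n
  obtain ⟨p, hp, hlim⟩ := G.exists_tendsto_transition hadj hα hs hdiv hsc hconv
  -- Edges are now reversed: the operator acts on measures instead of functions, and its fixed
  -- points are invariant laws.
  have hirr : ∀ i j, Relation.ReflTransGen
      (fun a b => ∃ e : G.Edge, e.1.2 = a ∧ e.1.1 = b) i j := fun i j =>
    Relation.ReflTransGen.mono (fun a b h => ⟨⟨(b, a), h⟩, rfl, rfl⟩) i j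
      (Relation.ReflTransGen.swap i j (hsc j i))
  set W : ℕ → ℝ := fun n => ∑ e, α e + 2 * n with hW
  have hWpos : ∀ n, 0 < W n := fun n => by
    simp only [hW]
    rw [← G.sum_weight hadj]
    exact Finset.sum_pos (fun e _ => G.weight_pos hα n e) ⟨⟨(x 0, x 1), hadj 0⟩, Finset.mem_univ _⟩
  have hnat : Tendsto (fun n : ℕ => (n : ℝ)) atTop atTop := tendsto_natCast_atTop_atTop
  have hWtop : Tendsto W atTop atTop :=
    tendsto_atTop_add_const_left _ _ (hnat.const_mul_atTop two_pos)
  have hvis : ∀ (b : ℕ → ℝ), Tendsto b atTop atTop → ∀ c : ℕ → ℝ, (∀ n, |c n| ≤ 1) →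
      Tendsto (fun n => c n / b n) atTop (𝓝 0) := by
    intro b hb c hc
    have hO : c =O[atTop] fun _ => (1 : ℝ) :=
      Asymptotics.isBigO_of_le _ fun n => by simpa using hc n
    refine (hO.trans_isLittleO ?_).tendsto_div_nhds_zero
    exact (Asymptotics.isLittleO_const_left).2 (Or.inr (tendsto_norm_atTop_atTop.comp hb))
  have hvsub : ∀ n m i j, |visitAt x n i - visitAt x m j| ≤ 1 := fun n m i j => by
    simp only [visitAt]
    split_ifs <;> norm_num
  obtain ⟨y, hy, hypos, hysum, hyfix⟩ := exists_tendsto_of_asymptotically_fixed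
    (s := fun e : G.Edge => e.1.2) (t := fun e => e.1.1) hp hirr hlim
    (un := fun n i => G.outSum (G.weight α x n) i / W n)
    (fun n i => (div_pos (hwpos n i) (hWpos n)).le)
    (Eventually.of_forall fun n => by
      rw [← Finset.sum_div, sum_outSum, G.sum_weight hadj, div_self (hWpos n).ne'])
    -- The defect of invariance is in-weight minus out-weight at `i`, a difference of two visit
    -- indicators over `W n`.
    (fun i => by
      refine (hvis W hWtop _ fun n => hvsub n n i (G.star i)).congr fun n => ?_
      rw [← G.outSum_weight_star hadj hs hdiv, ← G.inSum_eq_outSum_star (G.weight_dual hs n),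
        sub_div, inSum, Finset.sum_div]
      congr 1
      refine Finset.sum_congr rfl fun e _ => ?_
      have := (hwpos n e.1.1).ne'
      split_ifs
      · field_simp
      · simp)
  set z : G.Edge → ℝ := fun e => p e * y e.1.1 with hz
  have hzpos : ∀ e, 0 < z e := fun e => mul_pos (hp e) (hypos _)
  have hwz : ∀ e, Tendsto (fun n => G.weight α x n e / W n) atTop (𝓝 (z e)) := fun e =>
    ((hlim e).mul (hy e.1.1)).congr fun n => by
      have := (hwpos n e.1.1).ne'
      field_simp
  have hwtop : ∀ e, Tendsto (fun n => G.weight α x n e) atTop atTop := fun e =>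
    ((hwz e).pos_mul_atTop (hzpos e) hWtop).congr fun n => div_mul_cancel₀ _ (hWpos n).ne'
  have hWn : Tendsto (fun n : ℕ => W n / n) atTop (𝓝 2) := by
    have h := (hnat.const_div_atTop (∑ e, α e)).add_const 2
    rw [zero_add] at h
    refine h.congr' ?_
    filter_upwards [eventually_gt_atTop 0] with n hn
    have : (n : ℝ) ≠ 0 := by positivity
    simp only [hW]
    field_simp
  set N : ℕ → V → ℝ := fun n i => ∑ k ∈ Finset.range n, visitAt x k i with hN
  have hNe : ∀ e, Tendsto (fun n : ℕ => (G.crossings x n e - p e * N n e.1.1) / n) atTop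
      (𝓝 0) := by
    intro e
    obtain ⟨l, hl⟩ := hconv e
    -- Kronecker's lemma with the weight as multiplier turns score increments into crossings minus
    -- transition probabilities; the Cesàro limit `h3` then replaces those probabilities by `p e`.
    have h1 := tendsto_sum_mul_div_zero (G.weight_monotone e) (hwtop e) hl
    have h2 := (h1.mul (hwz e)).mul hWn
    have h3 : Tendsto (fun k => visitAt x k e.1.1 * (G.weight α x k e /
        G.outSum (G.weight α x k) e.1.1 - p e)) atTop (𝓝 0) := by
      refine squeeze_zero_norm (fun n => ?_) (tendsto_norm_zero.comp
        (by simpa using (hlim e).sub_const (p e)))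
      rw [norm_mul]
      refine mul_le_of_le_one_left (norm_nonneg _) ?_
      rw [Real.norm_of_nonneg (visitAt_nonneg _ _ _)]
      exact visitAt_le_one _ _ _
    have h4 := h2.add h3.cesaro
    simp only [zero_mul, add_zero] at h4
    refine h4.congr' ?_
    filter_upwards [eventually_gt_atTop 0] with n hn
    have hn' : (n : ℝ) ≠ 0 := by positivity
    have hw := (G.weight_pos (x := x) hα n e).ne'
    have hWn := (hWpos n).ne'
    have hsum : ∑ k ∈ Finset.range n, G.weight α x k e * (G.crossAt x k e / G.weight α x k e -
        visitAt x k e.1.1 / G.outSum (G.weight α x k) e.1.1) =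
        G.crossings x n e - p e * N n e.1.1 - ∑ k ∈ Finset.range n, visitAt x k e.1.1 *
          (G.weight α x k e / G.outSum (G.weight α x k) e.1.1 - p e) := by
      simp only [crossings_eq_sum, hN, Finset.mul_sum, ← Finset.sum_sub_distrib]
      refine Finset.sum_congr rfl fun k _ => ?_
      have := (G.weight_pos (x := x) hα k e).ne'
      field_simp
      ring
    rw [hsum]
    field_simp
    ring
  obtain ⟨g, hg, hgpos, hgsum, hgfix⟩ := exists_tendsto_of_asymptotically_fixed
    (s := fun e : G.Edge => e.1.2) (t := fun e => e.1.1) hp hirr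
    (kn := fun _ => p) (fun e => tendsto_const_nhds)
    (un := fun n i => N n i / n)
    (fun n i => div_nonneg (Finset.sum_nonneg fun k _ => visitAt_nonneg _ _ _) n.cast_nonneg)
    (by
      filter_upwards [eventually_gt_atTop 0] with n hn
      have hn' : (n : ℝ) ≠ 0 := by positivity
      rw [← Finset.sum_div, Finset.sum_comm]
      simp [visitAt, hn'])
    (fun i => by
      have h1 : Tendsto (fun n : ℕ => ∑ e : G.Edge, if e.1.2 = i then
          (G.crossings x n e - p e * N n e.1.1) / n else 0) atTop (𝓝 0) := by
        have h0 : (0 : ℝ) = ∑ _e : G.Edge, (0 : ℝ) := Finset.sum_const_zero.symm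
        conv => arg 3; rw [h0]
        refine tendsto_finsetSum _ fun e _ => ?_
        split_ifs
        · exact hNe e
        · exact tendsto_const_nhds
      have h2 := (hvis _ hnat _ fun n => hvsub n 0 i i).sub h1
      rw [sub_zero] at h2
      refine h2.congr fun n => ?_
      have h3 : visitAt x n i - visitAt x 0 i =
          ∑ e : G.Edge, (if e.1.2 = i then (G.crossings x n e : ℝ) else 0) - N n i := by
        have : ∑ e : G.Edge, (if e.1.2 = i then (G.crossings x n e : ℝ) else 0) =
            ∑ k ∈ Finset.range n, visitAt x (k + 1) i := by
          simp only [← G.inSum_crossAt hadj, inSum, crossings_eq_sum]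
          rw [Finset.sum_comm]
          refine Finset.sum_congr rfl fun e _ => ?_
          split_ifs <;> simp
        rw [this, hN, ← Finset.sum_sub_distrib, Finset.sum_range_sub fun k => visitAt x k i]
      rw [h3, sub_div, Finset.sum_div, sub_right_comm, ← Finset.sum_sub_distrib]
      congr 1
      refine Finset.sum_congr rfl fun e _ => ?_
      split_ifs
      · ring
      · simp)
  have hgy : g = y := positive_operator_fixed_unique hp hirr hgfix hgsum
    (fun i => (hypos i).le) hyfix hysum
  refine ⟨z, ⟨⟨hzpos, fun e => ?_, fun i => ?_⟩, ?_⟩, fun e => ?_⟩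
  · refine tendsto_nhds_unique (hwz e) ((hwz (G.dual e)).congr fun n => ?_)
    rw [G.weight_dual hs]
  · have h1 : G.outSum z i = y i := by
      refine tendsto_nhds_unique ?_ (hy i)
      simp only [outSum, Finset.sum_div]
      refine tendsto_finsetSum _ fun e _ => ?_
      split_ifs
      · exact hwz e
      · simp
    rw [StarDigraph.div, h1, ← hyfix i]
    exact sub_self _
  · refine tendsto_nhds_unique (tendsto_finsetSum _ fun e _ => hwz e)
      (tendsto_const_nhds.congr fun n => ?_)
    rw [← Finset.sum_div, G.sum_weight hadj, div_self (hWpos n).ne']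
  · have h := (hNe e).add ((hg e.1.1).const_mul (p e))
    rw [zero_add, hgy] at h
    exact h.congr fun n => by ring

end Path

end StarDigraph

/-! ### Dependence on finite path prefixes and one-step expectations. -/

namespace StarDigraph

open Classical

variable {V : Type*} (G : StarDigraph V) {α : G.Edge → ℝ} {x y : ℕ → V}

theorem crossAt_congr {k : ℕ} (h : ∀ l ≤ k + 1, x l = y l) : G.crossAt x k = G.crossAt y k := by
  funext e
  simp only [crossAt, h k k.le_succ, h (k + 1) le_rfl]

theorem weight_congr {n : ℕ} (h : ∀ k ≤ n, x k = y k) : G.weight α x n = G.weight α y n := by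
  funext e
  have h1 : ∀ e, (G.crossings x n e : ℝ) = G.crossings y n e := fun e => by
    rw [crossings_eq_sum, crossings_eq_sum]
    refine Finset.sum_congr rfl fun k hk => ?_
    rw [G.crossAt_congr fun l hl => h l (hl.trans (Finset.mem_range.1 hk))]
  simp only [weight, h1]

variable [Fintype V]

theorem score_congr {n : ℕ} (h : ∀ k ≤ n, x k = y k) : G.score α x n = G.score α y n := by
  funext e
  refine Finset.sum_congr rfl fun k hk => ?_
  have hk := Finset.mem_range.1 hk
  rw [G.crossAt_congr fun l hl => h l (hl.trans hk), visitAt, visitAt, h k hk.le,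
    G.weight_congr fun l hl => h l (hl.trans hk.le)]

theorem outSum_eq_sum_vertices (f : G.Edge → ℝ) (i : V) :
    G.outSum f i = ∑ j, if h : G.Adj i j then f ⟨(i, j), h⟩ else 0 := by
  have h1 : ∀ e : G.Edge, (if e.1.1 = i then f e else 0) =
      ∑ j, if e.1.1 = i ∧ e.1.2 = j then f e else 0 := fun e => by
    by_cases h : e.1.1 = i <;> simp [h]
  simp only [outSum, h1]
  rw [Finset.sum_comm]
  refine Finset.sum_congr rfl fun j _ => ?_
  split_ifs with h
  · rw [Finset.sum_eq_single ⟨(i, j), h⟩]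
    · simp
    · rintro ⟨⟨a, b⟩, hab⟩ _ hne
      refine if_neg ?_
      rintro ⟨rfl, rfl⟩
      exact hne rfl
    · simp
  · refine Finset.sum_eq_zero ?_
    rintro ⟨⟨a, b⟩, hab⟩ _
    refine if_neg ?_
    rintro ⟨rfl, rfl⟩
    exact h hab

theorem sum_jumpProb {n : ℕ} (h : G.outSum (G.weight α x n) (x n) ≠ 0) :
    ∑ j, G.jumpProb α x n j = 1 := by
  rw [← div_self h]
  nth_rewrite 1 [outSum_eq_sum_vertices]
  rw [Finset.sum_div]
  refine Finset.sum_congr rfl fun j _ => ?_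
  unfold jumpProb
  split_ifs <;> simp

omit [Fintype V] in
theorem crossAt_update (n : ℕ) (j : V) (e : G.Edge) :
    G.crossAt (Function.update x (n + 1) j) n e =
      if x n = e.1.1 ∧ j = e.1.2 then 1 else 0 := by
  simp [crossAt, Prod.ext_iff]

theorem sum_jumpProb_mul_crossAt (hα : ∀ e, 0 < α e) {n : ℕ} {e : G.Edge} (he : x n = e.1.1)
    (A B : ℝ) :
    ∑ j, G.jumpProb α x n j * (G.crossAt (Function.update x (n + 1) j) n e * A + B) =
      G.weight α x n e / G.outSum (G.weight α x n) e.1.1 * A + B := by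
  have ho : G.outSum (G.weight α x n) (x n) ≠ 0 := by
    rw [he]
    exact (G.outSum_pos (G.weight_pos hα n) e).ne'
  have hj : G.jumpProb α x n e.1.2 = G.weight α x n e / G.outSum (G.weight α x n) e.1.1 := by
    have h : G.Adj (x n) e.1.2 := by rw [he]; exact e.2
    have h' : (⟨(x n, e.1.2), h⟩ : G.Edge) = e := Subtype.ext (Prod.ext he rfl)
    rw [jumpProb, dif_pos h, h', he]
  simp only [mul_add, Finset.sum_add_distrib, ← Finset.sum_mul, G.sum_jumpProb ho, one_mul,
    crossAt_update, he, true_and]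
  simp [hj]

omit [Fintype V] in
variable (x) in
-- A crossing raises the weight w by at least 1 and at most 2, and w ≥ α_e, so the new weight is at
-- most (1 + 2/α_e)w. Hence 1/w² is bounded by (1 + 2/α_e) times the decrease of 1/w.
theorem sum_crossAt_div_sq_le (hα : ∀ e, 0 < α e) (n : ℕ) (e : G.Edge) :
    ∑ k ∈ Finset.range n, G.crossAt x k e / G.weight α x k e ^ 2 ≤ (1 + 2 / α e) / α e := by
  have key : ∑ k ∈ Finset.range n, G.crossAt x k e / G.weight α x k e ^ 2 ≤
      (1 + 2 / α e) * (1 / α e - 1 / G.weight α x n e) := by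
    induction n with
    | zero => simp [weight_zero]
    | succ n ih =>
      rw [Finset.sum_range_succ]
      have ha := hα e
      have hw := G.weight_pos (x := x) hα n e
      have hw' := G.weight_pos (x := x) hα (n + 1) e
      have haw : α e ≤ G.weight α x n e := by
        rw [← G.weight_zero α x e]
        exact G.weight_monotone e n.zero_le
      have hstep : G.crossAt x n e / G.weight α x n e ^ 2 ≤
          (1 + 2 / α e) * (1 / G.weight α x n e - 1 / G.weight α x (n + 1) e) := by
        by_cases hc : (x n, x (n + 1)) = e.1
        · have hc1 : G.crossAt x n e = 1 := if_pos hc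
          have hs := G.weight_succ α x n e
          have h0 := G.crossAt_nonneg x n (G.dual e)
          have h1 := G.crossAt_le_one x n (G.dual e)
          rw [hc1] at hs ⊢
          have h2 : G.weight α x (n + 1) e ≤ (1 + 2 / α e) * G.weight α x n e := by
            have h3 : 2 ≤ 2 / α e * G.weight α x n e := by
              rw [div_mul_eq_mul_div, le_div_iff₀ ha]
              linarith
            linarith
          have h4 : 1 / G.weight α x n e - 1 / G.weight α x (n + 1) e =
              (G.weight α x (n + 1) e - G.weight α x n e) /
                (G.weight α x n e * G.weight α x (n + 1) e) := by
            field_simp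
          rw [h4, mul_div_assoc', div_le_div_iff₀ (by positivity) (by positivity)]
          have h5 : (1 : ℝ) ≤ G.weight α x (n + 1) e - G.weight α x n e := by linarith
          calc 1 * (G.weight α x n e * G.weight α x (n + 1) e)
              ≤ G.weight α x n e * ((1 + 2 / α e) * G.weight α x n e) := by
                rw [one_mul]; gcongr
            _ = (1 + 2 / α e) * 1 * G.weight α x n e ^ 2 := by ring
            _ ≤ _ := by gcongr
        · have hc1 : G.crossAt x n e = 0 := if_neg hc
          rw [hc1, zero_div]
          have := one_div_le_one_div_of_le hw (G.weight_monotone (x := x) (α := α) e n.le_succ)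
          exact mul_nonneg (by positivity) (sub_nonneg.2 this)
      linarith
  refine key.trans ?_
  have ha := hα e
  rw [div_eq_mul_one_div (1 + 2 / α e)]
  refine mul_le_mul_of_nonneg_left ?_ (by positivity)
  linarith [one_div_pos.2 (G.weight_pos (x := x) hα n e)]

/-- The path that follows `t` and then stays at its last vertex. -/
def extendPath {n : ℕ} (t : Fin (n + 1) → V) (k : ℕ) : V := t ⟨min k n, by omega⟩

omit [Fintype V] in
theorem extendPath_eq {n k : ℕ} (t : Fin (n + 1) → V) (hk : k ≤ n) :
    extendPath t k = t ⟨k, by omega⟩ := by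
  simp [extendPath, hk]

omit [Fintype V] in
theorem forall_eq_extendPath_iff {n : ℕ} (t : Fin (n + 1) → V) :
    (∀ k ≤ n, x k = extendPath t k) ↔ t = fun k : Fin (n + 1) => x k := by
  constructor
  · intro h
    funext k
    rw [h k (Nat.lt_succ_iff.1 k.2), extendPath_eq t (Nat.lt_succ_iff.1 k.2)]
  · rintro rfl k hk
    rw [extendPath_eq _ hk]

/-! ### Martingale convergence for the random walk. -/

section Walk

variable {G} {i₀ : V} {Ω : Type*} [MeasurableSpace Ω] {P : Measure Ω} {X : ℕ → Ω → V}
  (hX : G.IsStarERRW α i₀ P X)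
include hX

theorem IsStarERRW.measurableSet_eq (k : ℕ) (v : V) : MeasurableSet {ω | X k ω = v} :=
  hX.measurable k (t := {v}) trivial

theorem IsStarERRW.measurableSet_cylinder (n : ℕ) (x : ℕ → V) :
    MeasurableSet {ω | ∀ k ≤ n, X k ω = x k} := by
  have : {ω | ∀ k ≤ n, X k ω = x k} = ⋂ k, ⋂ _ : k ≤ n, {ω | X k ω = x k} := by
    ext ω; simp
  rw [this]
  exact MeasurableSet.iInter fun k => MeasurableSet.iInter fun _ => hX.measurableSet_eq k _

variable [IsProbabilityMeasure P]

/-- On null cylinders both sides vanish, so the product form holds without exception. -/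
theorem IsStarERRW.real_inter (n : ℕ) (x : ℕ → V) (j : V) :
    P.real ({ω | ∀ k ≤ n, X k ω = x k} ∩ {ω | X (n + 1) ω = j}) =
      P.real {ω | ∀ k ≤ n, X k ω = x k} * G.jumpProb α x n j := by
  by_cases h : P {ω | ∀ k ≤ n, X k ω = x k} = 0
  · rw [measureReal_def, measureReal_def, measure_mono_null Set.inter_subset_left h, h]
    simp
  · have h' : P.real {ω | ∀ k ≤ n, X k ω = x k} ≠ 0 := by
      rw [measureReal_def, ENNReal.toReal_ne_zero]
      exact ⟨h, measure_ne_top _ _⟩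
    rw [← hX.step n x h j, measureReal_def (P[|_]),
      cond_apply (hX.measurableSet_cylinder n x), ENNReal.toReal_mul, ENNReal.toReal_inv]
    simp only [← measureReal_def]
    field_simp

omit [IsProbabilityMeasure P] in
theorem IsStarERRW.integrable_comp [IsFiniteMeasure P] (n : ℕ) {f : (ℕ → V) → ℝ}
    (hf : ∀ x y, (∀ k ≤ n, x k = y k) → f x = f y) :
    Integrable (fun ω => f fun k => X k ω) P := by
  have h : (fun ω => f fun k => X k ω) = fun ω => ∑ t : Fin (n + 1) → V,
      {ω | ∀ k ≤ n, X k ω = extendPath t k}.indicator (fun _ => f (extendPath t)) ω := by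
    funext ω
    rw [Finset.sum_eq_single fun k : Fin (n + 1) => X k ω]
    · have h1 := (forall_eq_extendPath_iff (x := fun k => X k ω) (n := n) _).2 rfl
      rw [Set.indicator_of_mem (by exact h1)]
      exact hf _ _ h1
    · intro t _ ht
      refine Set.indicator_of_notMem (fun h => ht ?_) _
      exact (forall_eq_extendPath_iff (x := fun k => X k ω) t).1 h
    · simp
  rw [h]
  exact integrable_finsetSum _ fun t _ =>
    (integrable_const _).indicator (hX.measurableSet_cylinder n _)

/-- The one-step formula for the expectation of a functional of the first `n + 2` positions. -/
theorem IsStarERRW.integral_comp_eq (n : ℕ) {f : (ℕ → V) → ℝ}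
    (hf : ∀ x y, (∀ k ≤ n + 1, x k = y k) → f x = f y) :
    ∫ ω, f (fun k => X k ω) ∂P = ∑ t : Fin (n + 1) → V,
      P.real {ω | ∀ k ≤ n, X k ω = extendPath t k} * ∑ j, G.jumpProb α (extendPath t) n j *
        f (Function.update (extendPath t) (n + 1) j) := by
  have h : (fun ω => f fun k => X k ω) = fun ω => ∑ t : Fin (n + 1) → V, ∑ j,
      ({ω | ∀ k ≤ n, X k ω = extendPath t k} ∩ {ω | X (n + 1) ω = j}).indicator
        (fun _ => f (Function.update (extendPath t) (n + 1) j)) ω := by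
    funext ω
    rw [Finset.sum_eq_single fun k : Fin (n + 1) => X k ω, Finset.sum_eq_single (X (n + 1) ω)]
    · have h1 := (forall_eq_extendPath_iff (x := fun k => X k ω) (n := n) _).2 rfl
      rw [Set.indicator_of_mem (by exact ⟨h1, rfl⟩)]
      refine hf _ _ fun k hk => ?_
      by_cases hkn : k = n + 1
      · subst hkn; simp
      · rw [Function.update_of_ne hkn]
        exact h1 k (by omega)
    · intro j _ hj
      exact Set.indicator_of_notMem (fun h => hj h.2.symm) _
    · simp
    · intro t _ ht
      refine Finset.sum_eq_zero fun j _ => Set.indicator_of_notMem (fun h => ht ?_) _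
      exact (forall_eq_extendPath_iff (x := fun k => X k ω) t).1 h.1
    · simp
  have hm : ∀ (t : Fin (n + 1) → V) j, MeasurableSet
      ({ω | ∀ k ≤ n, X k ω = extendPath t k} ∩ {ω | X (n + 1) ω = j}) := fun t j =>
    (hX.measurableSet_cylinder n _).inter (hX.measurableSet_eq _ j)
  rw [h, integral_finsetSum _ fun t _ => integrable_finsetSum _ fun j _ =>
    (integrable_const _).indicator (hm t j)]
  refine Finset.sum_congr rfl fun t _ => ?_
  rw [integral_finsetSum _ fun j _ => (integrable_const _).indicator (hm t j), Finset.mul_sum]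
  refine Finset.sum_congr rfl fun j _ => ?_
  rw [integral_indicator_const _ (hm t j), hX.real_inter, smul_eq_mul, mul_assoc]

theorem IsStarERRW.ae_adj : ∀ᵐ ω ∂P, ∀ n, G.Adj (X n ω) (X (n + 1) ω) := by
  rw [ae_all_iff]
  intro n
  set f : (ℕ → V) → ℝ := fun x => if G.Adj (x n) (x (n + 1)) then 0 else 1 with hf
  have hloc : ∀ x y : ℕ → V, (∀ k ≤ n + 1, x k = y k) → f x = f y := fun x y h => by
    simp only [hf, h n n.le_succ, h (n + 1) le_rfl]
  have h0 : ∫ ω, f (fun k => X k ω) ∂P = 0 := by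
    rw [hX.integral_comp_eq n hloc]
    refine Finset.sum_eq_zero fun t _ => mul_eq_zero_of_right _ <|
      Finset.sum_eq_zero fun j _ => ?_
    by_cases hj : G.Adj (extendPath t n) j
    · simp [hf, hj]
    · simp [jumpProb, hj]
  rw [integral_eq_zero_iff_of_nonneg (fun ω => by simp only [hf]; split_ifs <;> simp)
    (hX.integrable_comp (n + 1) hloc)] at h0
  filter_upwards [h0] with ω hω
  by_contra h
  simp [hf, h] at hω

omit hX [IsProbabilityMeasure P] [MeasurableSpace Ω] in
theorem score_update_succ (n : ℕ) (j : V) (e : G.Edge) :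
    G.score α (Function.update x (n + 1) j) (n + 1) e = G.score α x n e +
      (G.crossAt (Function.update x (n + 1) j) n e / G.weight α x n e -
        visitAt x n e.1.1 / G.outSum (G.weight α x n) e.1.1) := by
  have h : ∀ k ≤ n, Function.update x (n + 1) j k = x k := fun k hk =>
    Function.update_of_ne (by omega) _ _
  rw [← G.score_congr h, ← G.weight_congr h]
  simp only [score, Finset.sum_range_succ, visitAt, h n le_rfl]

theorem IsStarERRW.integral_score_sq_le (hα : ∀ e, 0 < α e) (n : ℕ) (e : G.Edge) :
    ∫ ω, G.score α (fun k => X k ω) n e ^ 2 ∂P ≤ (1 + 2 / α e) / α e := by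
  set R : ℕ → (ℕ → V) → ℝ := fun n x =>
    ∑ k ∈ Finset.range n, G.crossAt x k e / G.weight α x k e ^ 2 with hR
  have hRloc : ∀ n, ∀ x y : ℕ → V, (∀ k ≤ n, x k = y k) → R n x = R n y := by
    intro n x y h
    refine Finset.sum_congr rfl fun k hk => ?_
    have hk := Finset.mem_range.1 hk
    rw [G.crossAt_congr fun l hl => h l (hl.trans hk),
      G.weight_congr fun l hl => h l (hl.trans hk.le)]
  have hSloc : ∀ n, ∀ x y : ℕ → V, (∀ k ≤ n, x k = y k) →
      G.score α x n e ^ 2 = G.score α y n e ^ 2 := fun n x y h => by rw [G.score_congr h]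
  have hRint := fun n => hX.integrable_comp n (hRloc n)
  have hSint := fun n => hX.integrable_comp n (hSloc n)
  have hle : ∫ ω, G.score α (fun k => X k ω) n e ^ 2 ∂P ≤ ∫ ω, R n (fun k => X k ω) ∂P := by
    induction n with
    | zero => simp [score, hR]
    | succ n ih =>
      set f : (ℕ → V) → ℝ := fun x => G.score α x (n + 1) e ^ 2 - G.score α x n e ^ 2 -
        (R (n + 1) x - R n x) with hf
      have hloc : ∀ x y : ℕ → V, (∀ k ≤ n + 1, x k = y k) → f x = f y := fun x y h => by
        have h' : ∀ k ≤ n, x k = y k := fun k hk => h k (by omega)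
        simp only [hf, G.score_congr h, G.score_congr h', hRloc _ x y h, hRloc _ x y h']
      have hstep : ∫ ω, f (fun k => X k ω) ∂P ≤ 0 := by
        rw [hX.integral_comp_eq n hloc]
        refine Finset.sum_nonpos fun t _ => mul_nonpos_of_nonneg_of_nonpos measureReal_nonneg ?_
        set x := extendPath t
        have hx : ∀ j, ∀ k ≤ n, Function.update x (n + 1) j k = x k := fun j k hk =>
          Function.update_of_ne (by omega) _ _
        have hfx : ∀ j, f (Function.update x (n + 1) j) =
            (G.score α x n e + (G.crossAt (Function.update x (n + 1) j) n e / G.weight α x n e -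
              visitAt x n e.1.1 / G.outSum (G.weight α x n) e.1.1)) ^ 2 - G.score α x n e ^ 2 -
            G.crossAt (Function.update x (n + 1) j) n e / G.weight α x n e ^ 2 := fun j => by
          simp only [hf, score_update_succ, G.score_congr (hx j), hR, Finset.sum_range_succ,
            add_sub_cancel_left, G.weight_congr (hx j)]
        by_cases hv : x n = e.1.1
        · have hw := (G.weight_pos (x := x) hα n e).ne'
          have ho := (G.outSum_pos (G.weight_pos (x := x) hα n) e).ne'
          -- The crossing indicator equals its square, so the expression is affine in it; its mean
          -- is minus the squared compensator increment.
          have hfx' : ∀ j, f (Function.update x (n + 1) j) =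
              G.crossAt (Function.update x (n + 1) j) n e *
                (2 * G.score α x n e / G.weight α x n e -
                  2 / (G.weight α x n e * G.outSum (G.weight α x n) e.1.1)) +
              (1 / G.outSum (G.weight α x n) e.1.1 ^ 2 -
                2 * G.score α x n e / G.outSum (G.weight α x n) e.1.1) := fun j => by
            rw [hfx, visitAt, if_pos hv, crossAt_update]
            split_ifs
            · field_simp
              ring
            · field_simp
              ring
          simp only [hfx', G.sum_jumpProb_mul_crossAt hα hv]
          have : 0 ≤ 1 / G.outSum (G.weight α x n) e.1.1 ^ 2 := by positivity
          have h2 : G.weight α x n e / G.outSum (G.weight α x n) e.1.1 *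
              (2 * G.score α x n e / G.weight α x n e -
                  2 / (G.weight α x n e * G.outSum (G.weight α x n) e.1.1)) +
              (1 / G.outSum (G.weight α x n) e.1.1 ^ 2 -
                2 * G.score α x n e / G.outSum (G.weight α x n) e.1.1) =
              -(1 / G.outSum (G.weight α x n) e.1.1 ^ 2) := by
            field_simp
            ring
          rw [h2]
          linarith
        · refine (Finset.sum_eq_zero fun j _ => ?_).le
          rw [hfx, visitAt, if_neg hv, crossAt_update, if_neg fun h => hv h.1]
          simp
      have hsplit := integral_sub ((hSint (n + 1)).sub (hSint n)) ((hRint (n + 1)).sub (hRint n))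
      rw [integral_sub' (hSint _) (hSint _), integral_sub' (hRint _) (hRint _)] at hsplit
      simp only [Pi.sub_apply] at hsplit
      simp only [hf] at hstep
      linarith
  refine hle.trans ?_
  have := integral_mono (hRint n) (integrable_const ((1 + 2 / α e) / α e))
    fun ω => G.sum_crossAt_div_sq_le (fun k => X k ω) hα n e
  simpa using this

/-- The scores of the walk are martingales bounded in `L²`, hence converge. -/
theorem IsStarERRW.ae_exists_tendsto_score (hα : ∀ e, 0 < α e) (e : G.Edge) :
    ∀ᵐ ω ∂P, ∃ l, Tendsto (fun n => G.score α (fun k => X k ω) n e) atTop (𝓝 l) := by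
  have hSloc : ∀ n, ∀ x y : ℕ → V, (∀ k ≤ n, x k = y k) →
      G.score α x n e = G.score α y n e := fun n x y h => by rw [G.score_congr h]
  have hSint := fun n => hX.integrable_comp n (hSloc n)
  let ℱ : Filtration ℕ ‹MeasurableSpace Ω› :=
    { seq := fun n => MeasurableSpace.comap (fun ω (k : Fin (n + 1)) => X k ω) ⊤
      mono' := by
        rintro n m hnm _ ⟨B, -, rfl⟩
        exact ⟨(fun t (k : Fin (n + 1)) => t ⟨k, by omega⟩) ⁻¹' B, trivial, rfl⟩
      le' := by
        intro n
        rw [← measurable_iff_comap_le]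
        refine @measurable_to_countable _ _ ⊤ _ _ _ fun ω₀ => ?_
        convert hX.measurableSet_cylinder n
          (extendPath fun k : Fin (n + 1) => X k ω₀) using 1
        ext ω
        simp only [Set.mem_preimage, Set.mem_singleton_iff, Set.mem_ofPred_eq]
        rw [forall_eq_extendPath_iff (x := fun k => X k ω), eq_comm] }
  have hmart : Martingale (fun n ω => G.score α (fun k => X k ω) n e) ℱ P := by
    refine martingale_of_setIntegral_eq_succ (fun n => ?_) hSint ?_
    · have h : (fun ω => G.score α (fun k => X k ω) n e) =
          (fun t : Fin (n + 1) → V => G.score α (extendPath t) n e) ∘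
            fun ω (k : Fin (n + 1)) => X k ω := by
        funext ω
        exact hSloc n _ _ ((forall_eq_extendPath_iff (x := fun k => X k ω) (n := n) _).2 rfl)
      rw [h]
      refine Measurable.stronglyMeasurable ?_
      refine @Measurable.comp _ _ _ (ℱ n) ⊤ _ _ _ (fun _ _ => trivial) ?_
      exact comap_measurable _
    · rintro n _ ⟨B, -, rfl⟩
      set s := (fun ω (k : Fin (n + 1)) => X k ω) ⁻¹' B
      have hs : MeasurableSet s := ℱ.le n _ ⟨B, trivial, rfl⟩
      rw [eq_comm, ← sub_eq_zero,
        ← integral_sub (hSint _).integrableOn (hSint _).integrableOn, ← integral_indicator hs]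
      set f : (ℕ → V) → ℝ := fun x => if (fun k : Fin (n + 1) => x k) ∈ B then
        G.score α x (n + 1) e - G.score α x n e else 0 with hf
      have hloc : ∀ x y : ℕ → V, (∀ k ≤ n + 1, x k = y k) → f x = f y := fun x y h => by
        have h' : ∀ k ≤ n, x k = y k := fun k hk => h k (by omega)
        have h'' : (fun k : Fin (n + 1) => x k) = fun k : Fin (n + 1) => y k :=
          funext fun k => h k (by omega)
        simp only [hf, G.score_congr h, G.score_congr h', h'']
      have hfs : s.indicator (fun ω => G.score α (fun k => X k ω) (n + 1) e -
          G.score α (fun k => X k ω) n e) = fun ω => f fun k => X k ω := by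
        funext ω
        simp only [Set.indicator, hf, s, Set.mem_preimage]
      rw [hfs, hX.integral_comp_eq n hloc]
      refine Finset.sum_eq_zero fun t _ => mul_eq_zero_of_right _ ?_
      set x := extendPath t
      have hx : ∀ j, ∀ k ≤ n, Function.update x (n + 1) j k = x k := fun j k hk =>
        Function.update_of_ne (by omega) _ _
      have hx' : ∀ j, (fun k : Fin (n + 1) => Function.update x (n + 1) j k) =
          fun k : Fin (n + 1) => x k := fun j => funext fun k => hx j k (by omega)
      by_cases hB : (fun k : Fin (n + 1) => x k) ∈ B
      · have hfx : ∀ j, f (Function.update x (n + 1) j) =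
            G.crossAt (Function.update x (n + 1) j) n e * (1 / G.weight α x n e) +
              -(visitAt x n e.1.1 / G.outSum (G.weight α x n) e.1.1) := fun j => by
          simp only [hf, hx' j, if_pos hB, score_update_succ, G.score_congr (hx j)]
          ring
        by_cases hv : x n = e.1.1
        · have hw := (G.weight_pos (x := x) hα n e).ne'
          simp only [hfx, G.sum_jumpProb_mul_crossAt hα hv, visitAt, if_pos hv]
          field_simp
          ring
        · refine Finset.sum_eq_zero fun j _ => ?_
          rw [hfx, visitAt, if_neg hv, crossAt_update, if_neg fun h => hv h.1]
          simp
      · refine Finset.sum_eq_zero fun j _ => ?_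
        simp only [hf, hx' j, if_neg hB, mul_zero]
  refine hmart.submartingale.exists_ae_tendsto_of_bdd
    (R := Real.toNNReal (1 + (1 + 2 / α e) / α e)) fun n => ?_
  rw [eLpNorm_one_eq_lintegral_enorm, ← ofReal_integral_norm_eq_lintegral_enorm (hSint n)]
  refine ENNReal.ofReal_le_ofReal ?_
  have hsq := hX.integrable_comp n (f := fun x => G.score α x n e ^ 2)
    fun x y h => by rw [G.score_congr h]
  -- The bound |s| ≤ 1 + s² turns the L² bound into the L¹ bound needed for martingale convergence.
  have h1 := integral_mono (hSint n).norm ((integrable_const (1 : ℝ)).add hsq) fun ω => by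
    simp only [Pi.add_apply, Real.norm_eq_abs]
    nlinarith [sq_abs (G.score α (fun k => X k ω) n e),
      sq_nonneg (|G.score α (fun k => X k ω) n e| - 1)]
  rw [integral_add' (integrable_const _) hsq] at h1
  have h2 := hX.integral_score_sq_le hα n e
  simp only [integral_const, probReal_univ, one_smul] at h1
  linarith

omit [IsProbabilityMeasure P] in
theorem IsStarERRW.measurable_crossings (n : ℕ) (e : G.Edge) :
    Measurable fun ω => (G.crossings (fun k => X k ω) n e : ℝ) := by
  simp only [crossings_eq_sum]
  refine Finset.measurable_sum _ fun k _ => ?_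
  refine Measurable.ite ?_ measurable_const measurable_const
  have : {ω | (X k ω, X (k + 1) ω) = e.1} = {ω | X k ω = e.1.1} ∩ {ω | X (k + 1) ω = e.1.2} := by
    ext ω
    simp [Prod.ext_iff]
  rw [this]
  exact (hX.measurableSet_eq _ _).inter (hX.measurableSet_eq _ _)

end Walk

end StarDigraph

theorem corollary1 {V : Type*} [Finite V] (G : StarDigraph V) (hG : G.StarConnected)
    (α : G.Edge → ℝ) (hα_pos : ∀ e, 0 < α e) (hα_symm : ∀ e, α e = α (G.dual e))
    (i₀ : V) (hα_div : G.DivergenceAssumption α i₀) (hi₀ : G.Reachable i₀ (G.star i₀))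
    {Ω : Type*} [MeasurableSpace Ω] (P : Measure Ω) [IsProbabilityMeasure P]
    (X : ℕ → Ω → V) (hX : G.IsStarERRW α i₀ P X) :
    ∃ Y : Ω → G.Edge → ℝ, Measurable Y ∧ ∀ᵐ ω ∂P,
      (∀ e : G.Edge,
        Tendsto (fun n : ℕ => (G.crossings (fun k => X k ω) n e : ℝ) / n) atTop (𝓝 (Y ω e))) ∧
      Y ω ∈ G.spaceL1 := by
  have := Fintype.ofFinite V
  -- The limsup is defined and measurable everywhere, and equals the limit wherever that exists.
  refine ⟨fun ω e => limsup (fun n : ℕ => (G.crossings (fun k => X k ω) n e : ℝ) / n) atTop,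
    measurable_pi_lambda _ fun e => Measurable.limsup fun n =>
      (hX.measurable_crossings n e).div_const _, ?_⟩
  filter_upwards [hX.start, hX.ae_adj,
    ae_all_iff.2 fun e => hX.ae_exists_tendsto_score hα_pos e] with ω h0 hadj hconv
  obtain ⟨z, hz, hlim⟩ := G.exists_tendsto_crossings hadj hα_pos hα_symm (by rwa [h0])
    (G.reachable_of_starConnected hG hα_pos hα_div hi₀) hconv
  have hY : (fun e => limsup (fun n : ℕ => (G.crossings (fun k => X k ω) n e : ℝ) / n) atTop) = z :=
    funext fun e => (hlim e).limsup_eq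
  refine ⟨fun e => ?_, ?_⟩
  · rw [(hlim e).limsup_eq]
    exact hlim e
  · rw [hY]
    exact hz
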